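/- A cylindric partition with profile $c=(1,1,0,0)$ is a tuple $\Lambda=(\lambda^{(1)},\lambda^{(2)},\lambda^{(3)},\lambda^{(4)})$ of ordinary partitions (non-increasing sequences $\lambda^{(i)}_1\ge\lambda^{(i)}_2\ge\cdots$ of non-negative integers with finitely many non-zero terms) such that $\lambda^{(i)}_j\ge\lambda^{(i+1)}_{j+c_{i+1}}$ for $1\le i\le 3$ and $\lambda^{(4)}_j\ge\lambda^{(1)}_{j+c_1}$, for all $j\ge 1$. Its size $|\Lambda|$ is the sum of all the parts of the $\lambda^{(i)}$. Let $(a;q)_n=\prod_{k=1}^{n}(1-aq^{k-1})$ and $(a;q)_\infty=\lim_{n\to\infty}(a;q)_n$. Then for every complex $q$ with $|q|<1$ $$\sum_{\Lambda} q^{|\Lambda|}=\left(\sum_{n\ge 0}\frac{q^{n^2}}{(q^2;q^2)_n}\right)\cdot\frac{(-q^2;q^2)_\infty}{(q;q)_\infty},$$ where the sum on the left runs over all cylindric partitions $\Lambda$ with profile $(1,1,0,0)$; both series converge absolutely, both infinite products converge, and no denominator vanishes. -/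

import Mathlib

open Filter Topology

/-- A cylindric partition of rank `r` with profile `c = (c 0, …, c (r-1))`: an `r`-tuple of
ordinary partitions, each written as a non-increasing sequence of natural numbers padded with
zeros (`part i j` is the `(j+1)`-st part of the `(i+1)`-st partition), such that
`part i j ≥ part (i+1) (j + c (i+1))` for all `i`, `j`. Addition on `Fin r` is cyclic, so for the
last row the condition compares with the first row, shifted by its own entry of the profile. -/
@[ext]
structure CylindricPartition {r : ℕ} [NeZero r] (c : Fin r → ℕ) where
  part : Fin r → ℕ → ℕ
  antitone_part : ∀ i, Antitone (part i)
  finite_support : ∀ i, (Function.support (part i)).Finite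
  cylindric : ∀ i j, part (i + 1) (j + c (i + 1)) ≤ part i j

/-- The size of a cylindric partition: the sum of all parts of all its rows. -/
noncomputable def CylindricPartition.size {r : ℕ} [NeZero r] {c : Fin r → ℕ}
    (Λ : CylindricPartition c) : ℕ :=
  ∑ i, ∑ᶠ j, Λ.part i j

/-- The finite `q`-Pochhammer symbol `(a; q)_n = ∏_{k=1}^{n} (1 - a q^{k-1})`. -/
noncomputable def qPochhammer (a q : ℂ) (n : ℕ) : ℂ :=
  ∏ k ∈ Finset.range n, (1 - a * q ^ k)

/-- The infinite `q`-Pochhammer symbol `(a; q)_∞ = lim_{n → ∞} (a; q)_n`. -/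
noncomputable def qPochhammerInf (a q : ℂ) : ℂ :=
  limUnder atTop (qPochhammer a q)

/-! Rank and level trade places. The entries of a cylindric partition of profile $(1,1,0,0)$ split
into two chains, each following the cylindric inequalities round and round the four rows. Each chain
is a partition, the cylindric conditions become monotonicity along the chains, and monotonicity of
the rows becomes $b_{k+3}\le a_k$ and $a_{k+1}\le b_k$. So the objects to count are linked pairs of
partitions, that is, cylindric partitions of rank 2 with profile $(1,3)$ (`exists_chains_eq`,
`size_eq_pairSize`).

Let all parts be at most $N$. Stripping a leading part equal to $N$ from one member of a pair moves
one unit of the profile to the other side, so inclusion-exclusion gives linear recurrences among the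
profiles $(2,2)$, $(1,3)$, $(0,4)$. The alternating sums $\sum_s (-1)^s
q^{3s^2+es}/((q;q)_{N-s}(q;q)_{N+s})$ with $e=0,1,2$, as in a reflection argument, satisfy the same
recurrences. At the wall $(0,4)$ this rests on `reflectionSum_three`. The system has only one
solution, which gives `pairGF_eq_reflectionSum`.

As $N\to\infty$ with $e=1$, the sum tends to $(q;q)_\infty^{-2}\sum_s(-1)^sq^{3s^2+s}$, which equals
$(q^2;q^2)_\infty/(q;q)_\infty^2$ by the pentagonal number theorem at $q^2$. Since
$(q^2;q^2)_\infty=(q;q)_\infty(-q;q)_\infty$ and $(-q;q)_\infty=(-q;q^2)_\infty(-q^2;q^2)_\infty$,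
Euler's identity for $(-q;q^2)_\infty$ turns this into the stated product. -/

/-! ### Partitions with bounded parts -/

/-- The sequence `n, a 0, a 1, …`. -/
def natCons (n : ℕ) (a : ℕ → ℕ) : ℕ → ℕ
  | 0 => n
  | k + 1 => a k

@[simp] theorem natCons_succ (n : ℕ) (a : ℕ → ℕ) (k : ℕ) : natCons n a (k + 1) = a k := rfl

theorem natCons_head_tail (a : ℕ → ℕ) : natCons (a 0) (fun k => a (k + 1)) = a := by
  funext k; cases k <;> rfl

/-- Partitions, as non-increasing sequences padded with zeros, with all parts at most `N`. -/
def boundedPartitions (N : ℕ) : Set (ℕ → ℕ) :=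
  {a | Antitone a ∧ (Function.support a).Finite ∧ a 0 ≤ N}

theorem natCons_mem_boundedPartitions {N : ℕ} {a : ℕ → ℕ} :
    natCons N a ∈ boundedPartitions N ↔ a ∈ boundedPartitions N := by
  have hs : (Function.support (natCons N a)).Finite ↔ (Function.support a).Finite := by
    constructor
    · intro h
      exact (h.preimage (Nat.succ_injective.injOn)).subset fun k hk => by simpa using hk
    · intro h
      refine ((h.image Nat.succ).insert 0).subset fun k hk => ?_
      cases k with
      | zero => simp
      | succ k => exact Or.inr ⟨k, by simpa using hk, rfl⟩
  constructor
  · rintro ⟨h1, h2, -⟩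
    exact ⟨fun i j hij => h1 (Nat.succ_le_succ hij), hs.1 h2, h1 (Nat.zero_le 1)⟩
  · rintro ⟨h1, h2, h3⟩
    refine ⟨antitone_nat_of_succ_le fun k => ?_, hs.2 h2, le_rfl⟩
    cases k with
    | zero => exact h3
    | succ k => exact h1 (Nat.le_succ k)

theorem finsum_natCons (n : ℕ) {a : ℕ → ℕ} (ha : (Function.support a).Finite) :
    ∑ᶠ j, natCons n a j = n + ∑ᶠ j, a j := by
  have hs : (Function.support (natCons n a)).Finite := by
    refine ((ha.image Nat.succ).insert 0).subset fun k hk => ?_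
    cases k with
    | zero => simp
    | succ k => exact Or.inr ⟨k, by simpa using hk, rfl⟩
  rw [← tsum_eq_finsum (L := .unconditional ℕ) hs, ← tsum_eq_finsum (L := .unconditional ℕ) ha, tsum_eq_zero_add']
  · rfl
  · exact summable_of_hasFiniteSupport ha

theorem boundedPartitions_zero : boundedPartitions 0 = {0} := by
  ext a
  constructor
  · rintro ⟨h1, -, h3⟩
    funext k
    exact Nat.le_zero.1 ((h1 (Nat.zero_le k)).trans h3)
  · rintro rfl
    exact ⟨fun _ _ _ => le_rfl, by simp, le_rfl⟩

theorem exists_length_of_mem_boundedPartitions {N : ℕ} {a : ℕ → ℕ}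
    (ha : a ∈ boundedPartitions N) : ∃ k, ∀ j, a j ≠ 0 ↔ j < k := by
  classical
  obtain ⟨h1, h2, -⟩ := ha
  have hex : ∃ k, a k = 0 := by
    obtain ⟨k, hk⟩ := h2.infinite_compl.nonempty
    exact ⟨k, by simpa using hk⟩
  refine ⟨Nat.find hex, fun j => ⟨fun hj => ?_, fun hj => Nat.find_min hex hj⟩⟩
  by_contra hlt
  have := h1 (not_lt.1 hlt)
  rw [Nat.find_spec hex] at this
  exact hj (Nat.le_zero.1 this)

/-- Removing the first column of the diagram sends a partition to its length together with a
partition whose parts are at most $N$. This map is injective and additive in size, so the series is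
dominated by a geometric series times the series for $N$. -/
theorem summable_boundedPartitions {r : ℝ} (h0 : 0 ≤ r) (h1 : r < 1) (N : ℕ) :
    Summable fun a : boundedPartitions N => r ^ (∑ᶠ j, a.1 j) := by
  induction N with
  | zero =>
    have : Finite (boundedPartitions 0) := by
      rw [boundedPartitions_zero]; infer_instance
    exact Summable.of_finite
  | succ N ih =>
    choose k hk using fun a : boundedPartitions (N + 1) =>
      exists_length_of_mem_boundedPartitions a.2
    have hmem (a : boundedPartitions (N + 1)) :
        (fun j => a.1 j - 1) ∈ boundedPartitions N := by
      obtain ⟨a, h1, h2, h3⟩ := a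
      refine ⟨fun i j hij => Nat.sub_le_sub_right (h1 hij) 1, h2.subset fun j hj => ?_, ?_⟩
      · simp only [Function.mem_support] at hj ⊢
        omega
      · simpa using h3
    let g : boundedPartitions (N + 1) → ℕ × boundedPartitions N := fun a => (k a, ⟨_, hmem a⟩)
    have hg : Function.Injective g := by
      intro a b hab
      ext j
      have e1 : k a = k b := congrArg Prod.fst hab
      have e2 : a.1 j - 1 = b.1 j - 1 := congrFun (congrArg (fun p => p.2.1) hab) j
      have := hk a j
      have := hk b j
      rw [← e1] at this
      by_cases hj : j < k a
      · have : a.1 j ≠ 0 := by tauto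
        have : b.1 j ≠ 0 := by tauto
        omega
      · have : a.1 j = 0 := by tauto
        have : b.1 j = 0 := by tauto
        omega
    have hsum := (summable_geometric_of_lt_one h0 h1).mul_of_nonneg ih
      (fun n => pow_nonneg h0 n) (fun a => pow_nonneg h0 _)
    refine (hsum.comp_injective hg).congr fun a => ?_
    have key : ∑ᶠ j, a.1 j = k a + ∑ᶠ j, (a.1 j - 1) := by
      rw [finsum_eq_sum_of_support_subset (s := Finset.range (k a)),
        finsum_eq_sum_of_support_subset (s := Finset.range (k a))]
      · calc ∑ j ∈ Finset.range (k a), a.1 j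
            = ∑ j ∈ Finset.range (k a), (1 + (a.1 j - 1)) := by
              refine Finset.sum_congr rfl fun j hj => ?_
              have := (hk a j).2 (Finset.mem_range.1 hj)
              omega
          _ = _ := by simp [Finset.sum_add_distrib]
      · intro j hj
        simp only [Function.mem_support] at hj
        have := (hk a j).1 (by omega)
        simpa using this
      · intro j hj
        simpa using (hk a j).1 hj
    rw [key, pow_add]
    rfl

/-! ### Linked pairs of partitions and their recurrences -/

/-- Pairs `(a, b)` of partitions with parts at most `N` such that `a k ≥ b (k + m)` and
`b k ≥ a (k + l)` for all `k`. -/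
def linkedPairs (l m N : ℕ) : Set ((ℕ → ℕ) × (ℕ → ℕ)) :=
  {p | p.1 ∈ boundedPartitions N ∧ p.2 ∈ boundedPartitions N ∧
    (∀ k, p.2 (k + m) ≤ p.1 k) ∧ ∀ k, p.1 (k + l) ≤ p.2 k}

/-- The sum of all parts of a pair of partitions. -/
noncomputable def pairSize (p : (ℕ → ℕ) × (ℕ → ℕ)) : ℕ := ∑ᶠ j, p.1 j + ∑ᶠ j, p.2 j

theorem pairSize_swap (p : (ℕ → ℕ) × (ℕ → ℕ)) : pairSize p.swap = pairSize p := add_comm _ _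

theorem swap_mem_linkedPairs {l m N : ℕ} {p : (ℕ → ℕ) × (ℕ → ℕ)} :
    p.swap ∈ linkedPairs l m N ↔ p ∈ linkedPairs m l N := by
  simp only [linkedPairs, Set.mem_ofPred_eq, Prod.fst_swap, Prod.snd_swap]
  tauto

/-- The generating function of a set of pairs of partitions by size. -/
noncomputable def pairGF (q : ℂ) (A : Set ((ℕ → ℕ) × (ℕ → ℕ))) : ℂ :=
  ∑' p : A, q ^ pairSize p

theorem summable_linkedPairs {q : ℂ} (hq : ‖q‖ < 1) (l m N : ℕ) :
    Summable fun p : linkedPairs l m N => q ^ pairSize p := by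
  have h := summable_boundedPartitions (norm_nonneg q) hq N
  have h0 (a : boundedPartitions N) : 0 ≤ ‖q‖ ^ (∑ᶠ j, a.1 j) := pow_nonneg (norm_nonneg q) _
  have h2 := h.mul_of_nonneg h h0 h0
  let g : linkedPairs l m N → boundedPartitions N × boundedPartitions N :=
    fun p => (⟨p.1.1, p.2.1⟩, ⟨p.1.2, p.2.2.1⟩)
  have hg : Function.Injective g := fun p p' hpp => by
    have e1 := congrArg Subtype.val (Prod.ext_iff.1 hpp).1
    have e2 := congrArg Subtype.val (Prod.ext_iff.1 hpp).2
    exact Subtype.ext (Prod.ext e1 e2)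
  have h3 := h2.comp_injective hg
  refine Summable.of_norm (h3.congr fun p => ?_)
  rw [norm_pow, pairSize, pow_add]
  rfl

theorem summable_indicator_of_subset_linkedPairs {q : ℂ} (hq : ‖q‖ < 1) {l m N : ℕ}
    {A : Set ((ℕ → ℕ) × (ℕ → ℕ))} (hA : A ⊆ linkedPairs l m N) :
    Summable (A.indicator fun p => q ^ pairSize p) := by
  have h : Summable ((linkedPairs l m N).indicator fun p => q ^ pairSize p) :=
    (summable_subtype_iff_indicator (f := fun p => q ^ pairSize p)).1
      (summable_linkedPairs hq l m N)
  have := h.indicator A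
  rwa [Set.indicator_indicator, Set.inter_eq_left.2 hA] at this

theorem pairGF_image_mul {q : ℂ} {A B : Set ((ℕ → ℕ) × (ℕ → ℕ))} {n : ℕ}
    (φ ψ : (ℕ → ℕ) × (ℕ → ℕ) → (ℕ → ℕ) × (ℕ → ℕ)) (hφ : ∀ p ∈ A, φ p ∈ B)
    (hψ : ∀ p ∈ B, ψ p ∈ A) (hψφ : ∀ p ∈ A, ψ (φ p) = p) (hφψ : ∀ p ∈ B, φ (ψ p) = p)
    (hs : ∀ p ∈ A, pairSize (φ p) = n + pairSize p) :
    pairGF q B = q ^ n * pairGF q A := by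
  let e : A ≃ B :=
    { toFun := fun p => ⟨φ p, hφ p p.2⟩
      invFun := fun p => ⟨ψ p, hψ p p.2⟩
      left_inv := fun p => Subtype.ext (hψφ p p.2)
      right_inv := fun p => Subtype.ext (hφψ p p.2) }
  rw [pairGF, pairGF, ← tsum_mul_left, ← e.tsum_eq]
  refine tsum_congr fun p => ?_
  change q ^ pairSize (φ p) = _
  rw [hs p p.2, pow_add]

theorem pairGF_swap (q : ℂ) (l m N : ℕ) :
    pairGF q (linkedPairs l m N) = pairGF q (linkedPairs m l N) := by
  rw [pairGF_image_mul (n := 0) (q := q) (A := linkedPairs m l N) Prod.swap Prod.swap, pow_zero,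
    one_mul]
  · exact fun p hp => swap_mem_linkedPairs.2 hp
  · exact fun p hp => swap_mem_linkedPairs.2 hp
  · exact fun p _ => p.swap_swap
  · exact fun p _ => p.swap_swap
  · exact fun p _ => by rw [pairSize_swap, zero_add]

/-- Prepending a part to the first member shifts its index by one, which tightens one link and
loosens the other. The one new inequality bounds an entry of `b` by `N`, which holds already. -/
theorem natCons_fst_mem_linkedPairs {l m N : ℕ} {a b : ℕ → ℕ} :
    (natCons N a, b) ∈ linkedPairs (l + 1) m N ↔ (a, b) ∈ linkedPairs l (m + 1) N := by
  simp only [linkedPairs, Set.mem_ofPred_eq, natCons_mem_boundedPartitions]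
  refine and_congr_right fun ha => and_congr_right fun hb => ?_
  refine and_congr ⟨fun h k => ?_, fun h k => ?_⟩ ⟨fun h k => ?_, fun h k => ?_⟩
  · have := h (k + 1)
    rwa [natCons_succ, add_right_comm] at this
  · cases k with
    | zero => exact (hb.1 (Nat.zero_le _)).trans hb.2.2
    | succ k =>
      have := h k
      rwa [natCons_succ, add_right_comm]
  · exact h k
  · exact h k

theorem pairSize_natCons_fst {l m N : ℕ} (n : ℕ) {p : (ℕ → ℕ) × (ℕ → ℕ)}
    (hp : p ∈ linkedPairs l m N) : pairSize (natCons n p.1, p.2) = n + pairSize p := by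
  simp only [pairSize, finsum_natCons n hp.1.2.1, add_assoc]

theorem pairGF_fst_eq_bound (q : ℂ) (l m N : ℕ) :
    pairGF q {p ∈ linkedPairs (l + 1) m N | p.1 0 = N} =
      q ^ N * pairGF q (linkedPairs l (m + 1) N) := by
  refine pairGF_image_mul (fun p => (natCons N p.1, p.2)) (fun p => (fun k => p.1 (k + 1), p.2))
    (fun p hp => ⟨natCons_fst_mem_linkedPairs.2 hp, rfl⟩) ?_ (fun p _ => rfl) ?_
    (fun p hp => pairSize_natCons_fst N hp)
  · rintro ⟨a, b⟩ ⟨hp, h0⟩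
    dsimp only at h0
    refine natCons_fst_mem_linkedPairs.1 ?_
    rw [← h0, natCons_head_tail, h0]
    exact hp
  · rintro ⟨a, b⟩ ⟨hp, h0⟩
    dsimp only at h0
    dsimp only
    rw [← h0, natCons_head_tail]

theorem pairGF_snd_eq_bound (q : ℂ) (l m N : ℕ) :
    pairGF q {p ∈ linkedPairs l (m + 1) N | p.2 0 = N} =
      q ^ N * pairGF q (linkedPairs (l + 1) m N) := by
  rw [pairGF_swap q (l + 1) m, ← pairGF_fst_eq_bound,
    pairGF_image_mul (n := 0) (q := q) (A := {p ∈ linkedPairs (m + 1) l N | p.1 0 = N})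
      Prod.swap Prod.swap, pow_zero, one_mul]
  · exact fun p hp => ⟨swap_mem_linkedPairs.2 hp.1, hp.2⟩
  · exact fun p hp => ⟨swap_mem_linkedPairs.2 hp.1, hp.2⟩
  · exact fun p _ => p.swap_swap
  · exact fun p _ => p.swap_swap
  · exact fun p _ => by rw [pairSize_swap, zero_add]

theorem natCons_natCons_mem_linkedPairs {l m N : ℕ} {a b : ℕ → ℕ} :
    (natCons N a, natCons N b) ∈ linkedPairs (l + 1) (m + 1) N ↔
      (a, b) ∈ linkedPairs (l + 1) (m + 1) N := by
  rw [natCons_fst_mem_linkedPairs, ← swap_mem_linkedPairs]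
  dsimp only [Prod.swap_prod_mk]
  rw [natCons_fst_mem_linkedPairs, ← swap_mem_linkedPairs]
  rfl

theorem pairGF_both_eq_bound (q : ℂ) (l m N : ℕ) :
    pairGF q {p ∈ linkedPairs (l + 1) (m + 1) N | p.1 0 = N ∧ p.2 0 = N} =
      q ^ (N + N) * pairGF q (linkedPairs (l + 1) (m + 1) N) := by
  refine pairGF_image_mul (fun p => (natCons N p.1, natCons N p.2))
    (fun p => (fun k => p.1 (k + 1), fun k => p.2 (k + 1)))
    (fun p hp => ⟨natCons_natCons_mem_linkedPairs.2 hp, rfl, rfl⟩) ?_ (fun p _ => rfl) ?_ ?_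
  · rintro ⟨a, b⟩ ⟨hp, h0, h1⟩
    dsimp only at h0 h1
    refine natCons_natCons_mem_linkedPairs.1 ?_
    rw [← h0, natCons_head_tail, h0, ← h1, natCons_head_tail, h1]
    exact hp
  · rintro ⟨a, b⟩ ⟨hp, h0, h1⟩
    dsimp only at h0 h1
    dsimp only
    rw [← h0, natCons_head_tail, h0, ← h1, natCons_head_tail]
  · intro p hp
    simp only [pairSize, finsum_natCons N hp.1.2.1, finsum_natCons N hp.2.1.2.1]
    ring

theorem mem_linkedPairs_of_succ {l m N : ℕ} {p : (ℕ → ℕ) × (ℕ → ℕ)} :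
    p ∈ linkedPairs l m N ↔
      p ∈ linkedPairs l m (N + 1) ∧ p.1 0 ≠ N + 1 ∧ p.2 0 ≠ N + 1 := by
  simp only [linkedPairs, boundedPartitions, Set.mem_ofPred_eq]
  constructor
  · rintro ⟨⟨h1, h2, h3⟩, ⟨h4, h5, h6⟩, h7, h8⟩
    exact ⟨⟨⟨h1, h2, by omega⟩, ⟨h4, h5, by omega⟩, h7, h8⟩, by omega, by omega⟩
  · rintro ⟨⟨⟨h1, h2, h3⟩, ⟨h4, h5, h6⟩, h7, h8⟩, h9, h10⟩
    exact ⟨⟨h1, h2, by omega⟩, ⟨h4, h5, by omega⟩, h7, h8⟩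

/-- Inclusion-exclusion on which of the two leading parts equals `N + 1`. Pairs where neither does
are those bounded by `N`. The recurrence is implicit: the bound `N + 1` also occurs on the right. -/
theorem pairGF_recurrence {q : ℂ} (hq : ‖q‖ < 1) (l m N : ℕ) :
    pairGF q (linkedPairs (l + 1) (m + 1) (N + 1)) =
      pairGF q (linkedPairs (l + 1) (m + 1) N) +
        q ^ (N + 1) * pairGF q (linkedPairs l (m + 2) (N + 1)) +
        q ^ (N + 1) * pairGF q (linkedPairs (l + 2) m (N + 1)) -
        q ^ (N + 1 + (N + 1)) * pairGF q (linkedPairs (l + 1) (m + 1) (N + 1)) := by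
  rw [← pairGF_fst_eq_bound, ← pairGF_snd_eq_bound, ← pairGF_both_eq_bound]
  simp only [pairGF, tsum_subtype _ (fun p => q ^ pairSize p)]
  have h1 := summable_indicator_of_subset_linkedPairs hq (l := l + 1) (m := m + 1) (N := N + 1)
    (A := linkedPairs (l + 1) (m + 1) N) fun p hp => (mem_linkedPairs_of_succ.1 hp).1
  have h2 := summable_indicator_of_subset_linkedPairs hq (l := l + 1) (m := m + 1) (N := N + 1)
    (A := {p ∈ linkedPairs (l + 1) (m + 1) (N + 1) | p.1 0 = N + 1}) fun p hp => hp.1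
  have h3 := summable_indicator_of_subset_linkedPairs hq (l := l + 1) (m := m + 1) (N := N + 1)
    (A := {p ∈ linkedPairs (l + 1) (m + 1) (N + 1) | p.2 0 = N + 1}) fun p hp => hp.1
  have h4 := summable_indicator_of_subset_linkedPairs hq (l := l + 1) (m := m + 1) (N := N + 1)
    (A := {p ∈ linkedPairs (l + 1) (m + 1) (N + 1) | p.1 0 = N + 1 ∧ p.2 0 = N + 1})
    fun p hp => hp.1
  rw [← h1.tsum_add h2, ← (h1.add h2).tsum_add h3, ← ((h1.add h2).add h3).tsum_sub h4]
  refine tsum_congr fun p => ?_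
  classical
  simp only [Set.indicator_apply, Set.mem_ofPred_eq,
    mem_linkedPairs_of_succ (l := l + 1) (m := m + 1) (N := N)]
  by_cases hp : p ∈ linkedPairs (l + 1) (m + 1) (N + 1) <;> by_cases ha : p.1 0 = N + 1 <;>
    by_cases hb : p.2 0 = N + 1 <;> simp [hp, ha, hb]

/-- At the wall `l = 0` the link gives `a 0 ≤ b 0`, so a maximal first part of `a` forces one of
`b`. Only the case of `b` remains, and inclusion-exclusion has no correction term. -/
theorem pairGF_recurrence_zero {q : ℂ} (hq : ‖q‖ < 1) (m N : ℕ) :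
    pairGF q (linkedPairs 0 (m + 1) (N + 1)) =
      pairGF q (linkedPairs 0 (m + 1) N) +
        q ^ (N + 1) * pairGF q (linkedPairs 1 m (N + 1)) := by
  rw [← zero_add 1, ← pairGF_snd_eq_bound, zero_add]
  simp only [pairGF, tsum_subtype _ (fun p => q ^ pairSize p)]
  have h1 := summable_indicator_of_subset_linkedPairs hq (l := 0) (m := m + 1) (N := N + 1)
    (A := linkedPairs 0 (m + 1) N) fun p hp => (mem_linkedPairs_of_succ.1 hp).1
  have h3 := summable_indicator_of_subset_linkedPairs hq (l := 0) (m := m + 1) (N := N + 1)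
    (A := {p ∈ linkedPairs 0 (m + 1) (N + 1) | p.2 0 = N + 1}) fun p hp => hp.1
  rw [← h1.tsum_add h3]
  refine tsum_congr fun p => ?_
  classical
  simp only [Set.indicator_apply, Set.mem_ofPred_eq,
    mem_linkedPairs_of_succ (l := 0) (m := m + 1) (N := N)]
  by_cases hp : p ∈ linkedPairs 0 (m + 1) (N + 1)
  · by_cases hb : p.2 0 = N + 1
    · simp [hp, hb]
    · have ha : p.1 0 ≠ N + 1 := fun ha => by
        have h5 := hp.2.2.2 0
        have h6 := hp.2.1.2.2
        simp only [zero_add] at h5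
        omega
      simp [hp, ha, hb]
  · simp [hp]

theorem pairGF_bound_zero (q : ℂ) (l m : ℕ) : pairGF q (linkedPairs l m 0) = 1 := by
  have h : linkedPairs l m 0 = {0} := by
    ext ⟨a, b⟩
    simp only [linkedPairs, boundedPartitions_zero, Set.mem_ofPred_eq, Set.mem_singleton_iff]
    constructor
    · rintro ⟨rfl, rfl, -⟩; rfl
    · intro h
      obtain ⟨rfl, rfl⟩ := Prod.mk.inj h
      simp
  rw [pairGF, h, tsum_singleton (0 : (ℕ → ℕ) × (ℕ → ℕ)) (fun p => q ^ pairSize p)]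
  simp [pairSize]

/-! ### From profile (1,1,0,0) to linked pairs -/

theorem finite_support_of_antitone_of_eq_zero {a : ℕ → ℕ} (ha : Antitone a) {k : ℕ}
    (hk : a k = 0) : (Function.support a).Finite := by
  refine (Set.finite_Iio k).subset fun j hj => ?_
  by_contra hjk
  exact hj (Nat.le_zero.1 (hk ▸ ha (not_lt.1 hjk)))

theorem exists_forall_ge_eq_zero {a : ℕ → ℕ} (ha : Antitone a)
    (hs : (Function.support a).Finite) : ∃ k, ∀ j, k ≤ j → a j = 0 := by
  obtain ⟨k, hk⟩ := exists_length_of_mem_boundedPartitions (N := a 0) ⟨ha, hs, le_rfl⟩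
  exact ⟨k, fun j hj => by by_contra h; exact absurd ((hk j).1 h) (not_lt.2 hj)⟩

theorem finsum_even_add_odd {f : ℕ → ℕ} (hf : (Function.support f).Finite) :
    ∑ᶠ k, f k = ∑ᶠ k, f (2 * k) + ∑ᶠ k, f (2 * k + 1) := by
  have h0 : (Function.support fun k => f (2 * k)).Finite :=
    hf.preimage (f := fun k => 2 * k) fun _ _ _ _ h => by dsimp only at h; omega
  have h1 : (Function.support fun k => f (2 * k + 1)).Finite :=
    hf.preimage (f := fun k => 2 * k + 1) fun _ _ _ _ h => by dsimp only at h; omega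
  rw [← tsum_eq_finsum (L := .unconditional ℕ) h0, ← tsum_eq_finsum (L := .unconditional ℕ) h1,
    ← tsum_eq_finsum (L := .unconditional ℕ) hf]
  exact (tsum_even_add_odd (summable_of_hasFiniteSupport h0)
    (summable_of_hasFiniteSupport h1)).symm

namespace CylindricPartition

section Conjugate

variable (Λ : CylindricPartition (![1, 1, 0, 0] : Fin 4 → ℕ))

theorem part_one_succ_le (j : ℕ) : Λ.part 1 (j + 1) ≤ Λ.part 0 j := Λ.cylindric 0 j

theorem part_two_le (j : ℕ) : Λ.part 2 j ≤ Λ.part 1 j := Λ.cylindric 1 j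

theorem part_three_le (j : ℕ) : Λ.part 3 j ≤ Λ.part 2 j := Λ.cylindric 2 j

theorem part_zero_succ_le (j : ℕ) : Λ.part 0 (j + 1) ≤ Λ.part 3 j := Λ.cylindric 3 j

/-- The maximal chain of entries of `Λ` that starts at the first entry of the first row. -/
def chainFst (k : ℕ) : ℕ := Λ.part (Fin.ofNat 4 k) ((k + 3) / 4 + k / 4)

/-- The maximal chain of entries of `Λ` that starts at the first entry of the second row. -/
def chainSnd (k : ℕ) : ℕ := Λ.part (Fin.ofNat 4 (k + 1)) ((k + 1) / 4 + k / 4)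

theorem chainFst_four_mul (t : ℕ) : Λ.chainFst (4 * t) = Λ.part 0 (2 * t) := by
  rw [chainFst]; refine congr (congrArg Λ.part (Fin.ext ?_)) ?_
  · simp only [Fin.val_ofNat]; omega
  · omega

theorem chainFst_four_mul_add_one (t : ℕ) :
    Λ.chainFst (4 * t + 1) = Λ.part 1 (2 * t + 1) := by
  rw [chainFst]; refine congr (congrArg Λ.part (Fin.ext ?_)) ?_
  · simp only [Fin.val_ofNat]; omega
  · omega

theorem chainFst_four_mul_add_two (t : ℕ) :
    Λ.chainFst (4 * t + 2) = Λ.part 2 (2 * t + 1) := by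
  rw [chainFst]; refine congr (congrArg Λ.part (Fin.ext ?_)) ?_
  · simp only [Fin.val_ofNat]; omega
  · omega

theorem chainFst_four_mul_add_three (t : ℕ) :
    Λ.chainFst (4 * t + 3) = Λ.part 3 (2 * t + 1) := by
  rw [chainFst]; refine congr (congrArg Λ.part (Fin.ext ?_)) ?_
  · simp only [Fin.val_ofNat]; omega
  · omega

theorem chainSnd_four_mul (t : ℕ) : Λ.chainSnd (4 * t) = Λ.part 1 (2 * t) := by
  rw [chainSnd]; refine congr (congrArg Λ.part (Fin.ext ?_)) ?_
  · simp only [Fin.val_ofNat]; omega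
  · omega

theorem chainSnd_four_mul_add_one (t : ℕ) : Λ.chainSnd (4 * t + 1) = Λ.part 2 (2 * t) := by
  rw [chainSnd]; refine congr (congrArg Λ.part (Fin.ext ?_)) ?_
  · simp only [Fin.val_ofNat]; omega
  · omega

theorem chainSnd_four_mul_add_two (t : ℕ) : Λ.chainSnd (4 * t + 2) = Λ.part 3 (2 * t) := by
  rw [chainSnd]; refine congr (congrArg Λ.part (Fin.ext ?_)) ?_
  · simp only [Fin.val_ofNat]; omega
  · omega

theorem chainSnd_four_mul_add_three (t : ℕ) :
    Λ.chainSnd (4 * t + 3) = Λ.part 0 (2 * t + 1) := by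
  rw [chainSnd]; refine congr (congrArg Λ.part (Fin.ext ?_)) ?_
  · simp only [Fin.val_ofNat]; omega
  · omega

theorem exists_eq_four_mul_add (k : ℕ) :
    ∃ t, k = 4 * t ∨ k = 4 * t + 1 ∨ k = 4 * t + 2 ∨ k = 4 * t + 3 :=
  ⟨k / 4, by omega⟩

theorem antitone_chainFst : Antitone Λ.chainFst := by
  refine antitone_nat_of_succ_le fun k => ?_
  obtain ⟨t, rfl | rfl | rfl | rfl⟩ := exists_eq_four_mul_add k
  · rw [chainFst_four_mul_add_one, chainFst_four_mul]
    exact Λ.part_one_succ_le _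
  · rw [chainFst_four_mul_add_one, chainFst_four_mul_add_two]
    exact Λ.part_two_le _
  · rw [chainFst_four_mul_add_two, chainFst_four_mul_add_three]
    exact Λ.part_three_le _
  · rw [chainFst_four_mul_add_three, show 4 * t + 3 + 1 = 4 * (t + 1) by ring, chainFst_four_mul]
    exact Λ.part_zero_succ_le _

theorem antitone_chainSnd : Antitone Λ.chainSnd := by
  refine antitone_nat_of_succ_le fun k => ?_
  obtain ⟨t, rfl | rfl | rfl | rfl⟩ := exists_eq_four_mul_add k
  · rw [chainSnd_four_mul_add_one, chainSnd_four_mul]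
    exact Λ.part_two_le _
  · rw [chainSnd_four_mul_add_one, chainSnd_four_mul_add_two]
    exact Λ.part_three_le _
  · rw [chainSnd_four_mul_add_two, chainSnd_four_mul_add_three]
    exact Λ.part_zero_succ_le _
  · rw [chainSnd_four_mul_add_three, show 4 * t + 3 + 1 = 4 * (t + 1) by ring, chainSnd_four_mul]
    exact Λ.part_one_succ_le _

theorem finite_support_chainFst : (Function.support Λ.chainFst).Finite := by
  obtain ⟨k, hk⟩ := exists_forall_ge_eq_zero (Λ.antitone_part 0) (Λ.finite_support 0)
  refine finite_support_of_antitone_of_eq_zero Λ.antitone_chainFst (k := 4 * k) ?_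
  rw [chainFst_four_mul]
  exact hk _ (by omega)

theorem finite_support_chainSnd : (Function.support Λ.chainSnd).Finite := by
  obtain ⟨k, hk⟩ := exists_forall_ge_eq_zero (Λ.antitone_part 1) (Λ.finite_support 1)
  refine finite_support_of_antitone_of_eq_zero Λ.antitone_chainSnd (k := 4 * k) ?_
  rw [chainSnd_four_mul]
  exact hk _ (by omega)

/-- Within each row the columns alternate between the two chains, so the links are exactly the
inequalities between adjacent entries of a row: this lemma covers half of them and
`chainFst_add_one_le` the other half. -/
theorem chainSnd_add_three_le (k : ℕ) : Λ.chainSnd (k + 3) ≤ Λ.chainFst k := by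
  obtain ⟨t, rfl | rfl | rfl | rfl⟩ := exists_eq_four_mul_add k
  · rw [chainSnd_four_mul_add_three, chainFst_four_mul]
    exact Λ.antitone_part 0 (Nat.le_succ _)
  · rw [show 4 * t + 1 + 3 = 4 * (t + 1) by ring, chainSnd_four_mul, chainFst_four_mul_add_one]
    exact Λ.antitone_part 1 (by omega)
  · rw [show 4 * t + 2 + 3 = 4 * (t + 1) + 1 by ring, chainSnd_four_mul_add_one,
      chainFst_four_mul_add_two]
    exact Λ.antitone_part 2 (by omega)
  · rw [show 4 * t + 3 + 3 = 4 * (t + 1) + 2 by ring, chainSnd_four_mul_add_two,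
      chainFst_four_mul_add_three]
    exact Λ.antitone_part 3 (by omega)

theorem chainFst_add_one_le (k : ℕ) : Λ.chainFst (k + 1) ≤ Λ.chainSnd k := by
  obtain ⟨t, rfl | rfl | rfl | rfl⟩ := exists_eq_four_mul_add k
  · rw [chainFst_four_mul_add_one, chainSnd_four_mul]
    exact Λ.antitone_part 1 (by omega)
  · rw [chainFst_four_mul_add_two, chainSnd_four_mul_add_one]
    exact Λ.antitone_part 2 (by omega)
  · rw [chainFst_four_mul_add_three, chainSnd_four_mul_add_two]
    exact Λ.antitone_part 3 (by omega)
  · rw [show 4 * t + 3 + 1 = 4 * (t + 1) by ring, chainFst_four_mul, chainSnd_four_mul_add_three]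
    exact Λ.antitone_part 0 (by omega)

theorem chains_mem_linkedPairs {N : ℕ} (h0 : Λ.part 0 0 ≤ N) (h1 : Λ.part 1 0 ≤ N) :
    (Λ.chainFst, Λ.chainSnd) ∈ linkedPairs 1 3 N :=
  ⟨⟨Λ.antitone_chainFst, Λ.finite_support_chainFst, h0⟩,
    ⟨Λ.antitone_chainSnd, Λ.finite_support_chainSnd, h1⟩,
    Λ.chainSnd_add_three_le, Λ.chainFst_add_one_le⟩

theorem finsum_four_mul {f : ℕ → ℕ} (hf : (Function.support f).Finite) :
    ∑ᶠ k, f k = ∑ᶠ k, f (4 * k) + ∑ᶠ k, f (4 * k + 1) + ∑ᶠ k, f (4 * k + 2) +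
      ∑ᶠ k, f (4 * k + 3) := by
  have h0 : (Function.support fun k => f (2 * k)).Finite :=
    hf.preimage (f := fun k => 2 * k) fun _ _ _ _ h => by dsimp only at h; omega
  have h1 : (Function.support fun k => f (2 * k + 1)).Finite :=
    hf.preimage (f := fun k => 2 * k + 1) fun _ _ _ _ h => by dsimp only at h; omega
  rw [finsum_even_add_odd hf, finsum_even_add_odd h0, finsum_even_add_odd h1]
  simp only [mul_add, ← mul_assoc, Nat.reduceMul, mul_one, add_assoc, Nat.reduceAdd]
  ring

theorem size_eq_pairSize : Λ.size = pairSize (Λ.chainFst, Λ.chainSnd) := by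
  rw [pairSize, finsum_four_mul Λ.finite_support_chainFst,
    finsum_four_mul Λ.finite_support_chainSnd, size, Fin.sum_univ_four,
    finsum_even_add_odd (Λ.finite_support 0), finsum_even_add_odd (Λ.finite_support 1),
    finsum_even_add_odd (Λ.finite_support 2), finsum_even_add_odd (Λ.finite_support 3)]
  simp only [chainFst_four_mul, chainFst_four_mul_add_one, chainFst_four_mul_add_two,
    chainFst_four_mul_add_three, chainSnd_four_mul, chainSnd_four_mul_add_one,
    chainSnd_four_mul_add_two, chainSnd_four_mul_add_three]
  ring

end Conjugate

theorem chains_injective : Function.Injective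
    fun Λ : CylindricPartition (![1, 1, 0, 0] : Fin 4 → ℕ) => (Λ.chainFst, Λ.chainSnd) := by
  intro Λ M h
  have ha (k : ℕ) : Λ.chainFst k = M.chainFst k := congrFun (Prod.mk.inj h).1 k
  have hb (k : ℕ) : Λ.chainSnd k = M.chainSnd k := congrFun (Prod.mk.inj h).2 k
  ext i j
  obtain ⟨t, rfl | rfl⟩ : ∃ t, j = 2 * t ∨ j = 2 * t + 1 := ⟨j / 2, by omega⟩
  · fin_cases i
    · exact (Λ.chainFst_four_mul t).symm.trans ((ha _).trans (M.chainFst_four_mul t))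
    · exact (Λ.chainSnd_four_mul t).symm.trans ((hb _).trans (M.chainSnd_four_mul t))
    · exact (Λ.chainSnd_four_mul_add_one t).symm.trans ((hb _).trans (M.chainSnd_four_mul_add_one t))
    · exact (Λ.chainSnd_four_mul_add_two t).symm.trans ((hb _).trans (M.chainSnd_four_mul_add_two t))
  · fin_cases i
    · exact (Λ.chainSnd_four_mul_add_three t).symm.trans ((hb _).trans (M.chainSnd_four_mul_add_three t))
    · exact (Λ.chainFst_four_mul_add_one t).symm.trans ((ha _).trans (M.chainFst_four_mul_add_one t))
    · exact (Λ.chainFst_four_mul_add_two t).symm.trans ((ha _).trans (M.chainFst_four_mul_add_two t))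
    · exact (Λ.chainFst_four_mul_add_three t).symm.trans ((ha _).trans (M.chainFst_four_mul_add_three t))

/-- The row `i` of the cylindric partition with chains `a` and `b`. -/
def rowOfChains (a b : ℕ → ℕ) (i : Fin 4) (j : ℕ) : ℕ :=
  if i = 0 then if j % 2 = 0 then a (2 * j) else b (2 * j + 1)
  -- The natural subtractions do not truncate: here `i ≥ 1`, and in the last branch `j` is odd.
  else if j % 2 = 0 then b (2 * j + i - 1) else a (2 * j - 2 + i)

/-- The dictionary read backwards: the links yield monotone rows, and monotone chains yield the
cylindric inequalities. -/
theorem exists_chains_eq {N : ℕ} {p : (ℕ → ℕ) × (ℕ → ℕ)} (hp : p ∈ linkedPairs 1 3 N) :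
    ∃ Λ : CylindricPartition (![1, 1, 0, 0] : Fin 4 → ℕ), (Λ.chainFst, Λ.chainSnd) = p := by
  obtain ⟨a, b⟩ := p
  obtain ⟨⟨ha, has, -⟩, ⟨hb, hbs, -⟩, hab, hba⟩ := hp
  dsimp only at ha has hb hbs hab hba
  have e0 (t : ℕ) : rowOfChains a b 0 (2 * t) = a (4 * t) := by
    simp [rowOfChains, ← mul_assoc]
  have e1 (t : ℕ) : rowOfChains a b 1 (2 * t) = b (4 * t) := by
    simp [rowOfChains, ← mul_assoc]
  have e2 (t : ℕ) : rowOfChains a b 2 (2 * t) = b (4 * t + 1) := by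
    simp [rowOfChains, ← mul_assoc]
  have e3 (t : ℕ) : rowOfChains a b 3 (2 * t) = b (4 * t + 2) := by
    simp [rowOfChains, ← mul_assoc]
  have o0 (t : ℕ) : rowOfChains a b 0 (2 * t + 1) = b (4 * t + 3) := by
    simp [rowOfChains, mul_add, ← mul_assoc]
  have o1 (t : ℕ) : rowOfChains a b 1 (2 * t + 1) = a (4 * t + 1) := by
    simp [rowOfChains, mul_add, ← mul_assoc]
  have o2 (t : ℕ) : rowOfChains a b 2 (2 * t + 1) = a (4 * t + 2) := by
    simp [rowOfChains, mul_add, ← mul_assoc]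
  have o3 (t : ℕ) : rowOfChains a b 3 (2 * t + 1) = a (4 * t + 3) := by
    simp [rowOfChains, mul_add, ← mul_assoc]
  have anti (i : Fin 4) : Antitone (rowOfChains a b i) := by
    refine antitone_nat_of_succ_le fun j => ?_
    obtain ⟨t, rfl | rfl⟩ : ∃ t, j = 2 * t ∨ j = 2 * t + 1 := ⟨j / 2, by omega⟩
    · fin_cases i
      · exact (o0 t).trans_le ((hab (4 * t)).trans_eq (e0 t).symm)
      · exact (o1 t).trans_le ((hba (4 * t)).trans_eq (e1 t).symm)
      · exact (o2 t).trans_le ((hba (4 * t + 1)).trans_eq (e2 t).symm)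
      · exact (o3 t).trans_le ((hba (4 * t + 2)).trans_eq (e3 t).symm)
    · rw [show 2 * t + 1 + 1 = 2 * (t + 1) by ring]
      fin_cases i
      · exact (e0 _).trans_le ((hba (4 * t + 3)).trans_eq (o0 t).symm)
      · exact (e1 _).trans_le ((hab (4 * t + 1)).trans_eq (o1 t).symm)
      · exact (e2 _).trans_le ((hab (4 * t + 2)).trans_eq (o2 t).symm)
      · exact (e3 _).trans_le ((hab (4 * t + 3)).trans_eq (o3 t).symm)
  obtain ⟨k, hk⟩ := exists_forall_ge_eq_zero ha has
  let Λ : CylindricPartition (![1, 1, 0, 0] : Fin 4 → ℕ) :=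
    { part := rowOfChains a b
      antitone_part := anti
      finite_support := fun i => by
        -- In an odd column rows 1, 2, 3 hold entries of `a`, and row 0 holds an entry of `b`
        -- bounded through a link by one of `a`. Hence the end of `a` alone bounds every row.
        refine finite_support_of_antitone_of_eq_zero (anti i) (k := 2 * (k + 1) + 1) ?_
        fin_cases i
        · exact (o0 _).trans (Nat.le_zero.1 ((hab _).trans_eq (hk _ (by omega))))
        · exact (o1 _).trans (hk _ (by omega))
        · exact (o2 _).trans (hk _ (by omega))
        · exact (o3 _).trans (hk _ (by omega))
      cylindric := fun i j => by
        obtain ⟨t, rfl | rfl⟩ : ∃ t, j = 2 * t ∨ j = 2 * t + 1 := ⟨j / 2, by omega⟩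
        · fin_cases i
          · exact (o1 t).trans_le ((ha (Nat.le_succ _)).trans_eq (e0 t).symm)
          · exact (e2 t).trans_le ((hb (Nat.le_succ _)).trans_eq (e1 t).symm)
          · exact (e3 t).trans_le ((hb (Nat.le_succ _)).trans_eq (e2 t).symm)
          · exact (o0 t).trans_le ((hb (Nat.le_succ _)).trans_eq (e3 t).symm)
        · fin_cases i
          · exact (e1 (t + 1)).trans_le ((hb (Nat.le_succ _)).trans_eq (o0 t).symm)
          · exact (o2 t).trans_le ((ha (Nat.le_succ _)).trans_eq (o1 t).symm)
          · exact (o3 t).trans_le ((ha (Nat.le_succ _)).trans_eq (o2 t).symm)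
          · exact (e0 (t + 1)).trans_le ((ha (Nat.le_succ _)).trans_eq (o3 t).symm) }
  refine ⟨Λ, Prod.ext (funext fun k => ?_) (funext fun k => ?_)⟩
  · obtain ⟨t, rfl | rfl | rfl | rfl⟩ := exists_eq_four_mul_add k
    · exact (Λ.chainFst_four_mul t).trans (e0 t)
    · exact (Λ.chainFst_four_mul_add_one t).trans (o1 t)
    · exact (Λ.chainFst_four_mul_add_two t).trans (o2 t)
    · exact (Λ.chainFst_four_mul_add_three t).trans (o3 t)
  · obtain ⟨t, rfl | rfl | rfl | rfl⟩ := exists_eq_four_mul_add k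
    · exact (Λ.chainSnd_four_mul t).trans (e1 t)
    · exact (Λ.chainSnd_four_mul_add_one t).trans (e2 t)
    · exact (Λ.chainSnd_four_mul_add_two t).trans (e3 t)
    · exact (Λ.chainSnd_four_mul_add_three t).trans (o0 t)

end CylindricPartition

/-! ### The alternating sum and its recurrences -/

theorem one_sub_pow_ne_zero {q : ℂ} (hq : ‖q‖ < 1) {n : ℕ} (hn : n ≠ 0) : 1 - q ^ n ≠ 0 := by
  intro h
  have h1 : ‖q ^ n‖ < 1 := by
    rw [norm_pow]; exact pow_lt_one₀ (norm_nonneg q) hq hn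
  rw [← sub_eq_zero.1 h, norm_one] at h1
  exact lt_irrefl _ h1

theorem qPochhammer_self_ne_zero {q : ℂ} (hq : ‖q‖ < 1) (n : ℕ) : qPochhammer q q n ≠ 0 := by
  refine Finset.prod_ne_zero_iff.2 fun k _ => ?_
  rw [← pow_succ']
  exact one_sub_pow_ne_zero hq k.succ_ne_zero

theorem qPochhammer_succ (a q : ℂ) (n : ℕ) :
    qPochhammer a q (n + 1) = qPochhammer a q n * (1 - a * q ^ n) := Finset.prod_range_succ _ _

/-- The reciprocal `1 / (q; q)_n`, which is zero for negative `n`. -/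
noncomputable def qFactorialInv (q : ℂ) (n : ℤ) : ℂ :=
  if n < 0 then 0 else (qPochhammer q q n.toNat)⁻¹

theorem qFactorialInv_of_neg (q : ℂ) {n : ℤ} (hn : n < 0) : qFactorialInv q n = 0 := if_pos hn

theorem qFactorialInv_natCast (q : ℂ) (n : ℕ) : qFactorialInv q n = (qPochhammer q q n)⁻¹ := by
  rw [qFactorialInv, if_neg (by omega), Int.toNat_natCast]

/-- The value zero at negative integers makes this hold without exception: at `n = -1` the factor `1
- q ^ 0` vanishes. -/
theorem one_sub_zpow_mul_qFactorialInv {q : ℂ} (hq : ‖q‖ < 1) (n : ℤ) :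
    (1 - q ^ (n + 1)) * qFactorialInv q (n + 1) = qFactorialInv q n := by
  rcases lt_trichotomy n (-1) with hn | rfl | hn
  · rw [qFactorialInv_of_neg q (by omega : n < 0), qFactorialInv_of_neg q (by omega), mul_zero]
  · rw [qFactorialInv_of_neg q (by omega : (-1 : ℤ) < 0)]
    simp
  · obtain ⟨k, rfl⟩ := Int.eq_ofNat_of_zero_le (by omega : 0 ≤ n)
    rw [show (k : ℤ) + 1 = ((k + 1 : ℕ) : ℤ) by push_cast; ring, qFactorialInv_natCast,
      qFactorialInv_natCast, zpow_natCast, qPochhammer_succ, pow_succ', mul_inv]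
    have := one_sub_pow_ne_zero hq k.succ_ne_zero
    rw [pow_succ'] at this
    field_simp

/-- The general term of the alternating sum `reflectionSum`. -/
noncomputable def reflectionTerm (q : ℂ) (e N s : ℤ) : ℂ :=
  (-1) ^ s * q ^ (3 * s ^ 2 + e * s) * (qFactorialInv q (N - s) * qFactorialInv q (N + s))

/-- The alternating sum `∑ s, (-1)^s q^(3 s² + e s) / ((q; q)_(N-s) (q; q)_(N+s))`. -/
noncomputable def reflectionSum (q : ℂ) (e N : ℤ) : ℂ := ∑' s : ℤ, reflectionTerm q e N s

theorem reflectionTerm_eq_zero (q : ℂ) (e : ℤ) {N s : ℤ} (hs : s ∉ Set.Icc (-N) N) :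
    reflectionTerm q e N s = 0 := by
  have h : N - s < 0 ∨ N + s < 0 := by
    by_contra! h
    exact hs ⟨by omega, by omega⟩
  rcases h with h | h <;> simp [reflectionTerm, qFactorialInv_of_neg q h]

theorem summable_reflectionTerm (q : ℂ) (e N : ℤ) : Summable (reflectionTerm q e N) := by
  refine summable_of_hasFiniteSupport ((Set.finite_Icc (-N) N).subset fun s hs => ?_)
  by_contra h
  exact hs (reflectionTerm_eq_zero q e h)

theorem reflectionTerm_add_one {q : ℂ} (hq : q ≠ 0) (e N s : ℤ) :
    reflectionTerm q (e + 1) N s = q ^ s * reflectionTerm q e N s := by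
  rw [reflectionTerm, reflectionTerm, show 3 * s ^ 2 + (e + 1) * s = s + (3 * s ^ 2 + e * s) by ring,
    zpow_add₀ hq]
  ring

/-- Raising or lowering `e` by one multiplies the term by $q^{\pm s}$, so this is the expansion of
$(1-q^{N+1-s})(1-q^{N+1+s})=1-q^{N+1}(q^s+q^{-s})+q^{2(N+1)}$. -/
theorem reflectionTerm_recurrence {q : ℂ} (hq0 : q ≠ 0) (hq : ‖q‖ < 1) (e N s : ℤ) :
    reflectionTerm q e (N + 1) s = reflectionTerm q e N s +
      q ^ (N + 1) * reflectionTerm q (e + 1) (N + 1) s +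
      q ^ (N + 1) * reflectionTerm q (e - 1) (N + 1) s -
      q ^ (2 * (N + 1)) * reflectionTerm q e (N + 1) s := by
  obtain ⟨f, rfl⟩ : ∃ f, e = f + 1 := ⟨e - 1, by ring⟩
  rw [add_sub_cancel_right, reflectionTerm_add_one hq0 (f + 1), reflectionTerm_add_one hq0 f,
    reflectionTerm_add_one hq0 f]
  have h1 := one_sub_zpow_mul_qFactorialInv hq (N - s)
  have h2 := one_sub_zpow_mul_qFactorialInv hq (N + s)
  rw [show N - s + 1 = (N + 1) - s by ring] at h1
  rw [show N + s + 1 = (N + 1) + s by ring] at h2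
  simp only [reflectionTerm]
  rw [← h1, ← h2, zpow_sub₀ hq0, zpow_add₀ hq0 (N + 1) s, two_mul, zpow_add₀ hq0 (N + 1) (N + 1)]
  have := zpow_ne_zero s hq0
  field_simp
  ring

theorem reflectionSum_recurrence {q : ℂ} (hq0 : q ≠ 0) (hq : ‖q‖ < 1) (e N : ℤ) :
    reflectionSum q e (N + 1) = reflectionSum q e N +
      q ^ (N + 1) * reflectionSum q (e + 1) (N + 1) +
      q ^ (N + 1) * reflectionSum q (e - 1) (N + 1) -
      q ^ (2 * (N + 1)) * reflectionSum q e (N + 1) := by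
  simp only [reflectionSum, ← tsum_mul_left]
  have h1 := summable_reflectionTerm q e N
  have h2 := (summable_reflectionTerm q (e + 1) (N + 1)).mul_left (q ^ (N + 1))
  have h3 := (summable_reflectionTerm q (e - 1) (N + 1)).mul_left (q ^ (N + 1))
  have h4 := (summable_reflectionTerm q e (N + 1)).mul_left (q ^ (2 * (N + 1)))
  rw [← h1.tsum_add h2, ← (h1.add h2).tsum_add h3, ← ((h1.add h2).add h3).tsum_sub h4]
  exact tsum_congr fun s => reflectionTerm_recurrence hq0 hq e N s

theorem reflectionSum_neg (q : ℂ) (e N : ℤ) : reflectionSum q (-e) N = reflectionSum q e N := by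
  rw [reflectionSum, ← (Equiv.neg ℤ).tsum_eq]
  refine tsum_congr fun s => ?_
  simp only [reflectionTerm, Equiv.neg_apply, neg_sq, neg_mul_neg, sub_neg_eq_add,
    ← sub_eq_add_neg, zpow_neg]
  rw [mul_comm (qFactorialInv q (N + s)), ← inv_zpow, inv_neg_one]

/-- The boundary condition at the wall: it makes the terms with `e = 3` and $q^{2(N+1)}$ in the
recurrence for `e = 2` cancel. The difference of the two summands is
$(-1)^sq^{3s^2+3s}/((q;q)_{N-s-1}(q;q)_{N+s})$, which changes sign under $s\mapsto -1-s$, so it sums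
to zero. -/
theorem reflectionSum_three {q : ℂ} (hq0 : q ≠ 0) (hq : ‖q‖ < 1) (N : ℤ) :
    reflectionSum q 3 N = q ^ N * reflectionSum q 2 N := by
  have h2 := (summable_reflectionTerm q 2 N).mul_left (q ^ N)
  have h3 := summable_reflectionTerm q 3 N
  obtain ⟨f, hf⟩ : ∃ f : ℤ → ℂ,
      f = fun s => reflectionTerm q 3 N s - q ^ N * reflectionTerm q 2 N s := ⟨_, rfl⟩
  have hfs : Summable f := hf ▸ h3.sub h2
  have hrefl : ∑' s, f ((Equiv.subLeft (-1)) s) = ∑' s, f s := Equiv.tsum_eq _ f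
  have hpair (s : ℤ) : f s + f ((Equiv.subLeft (-1)) s) = 0 := by
    have v1 := one_sub_zpow_mul_qFactorialInv hq (N + s)
    have v2 := one_sub_zpow_mul_qFactorialInv hq (N - s - 1)
    rw [sub_add_cancel] at v2
    simp only [hf, reflectionTerm, Equiv.subLeft_apply]
    rw [show N - (-1 - s) = N + s + 1 by ring, show N + (-1 - s) = N - s - 1 by ring, ← v1, ← v2,
      show 3 * (-1 - s) ^ 2 + 3 * (-1 - s) = 3 * s ^ 2 + (s + s + s) by ring,
      show 3 * (-1 - s) ^ 2 + 2 * (-1 - s) = 3 * s ^ 2 + (s + s + s + s + 1) by ring,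
      show 3 * s = s + s + s by ring, show 2 * s = s + s by ring,
      zpow_sub₀ (by norm_num : (-1 : ℂ) ≠ 0), zpow_sub₀ hq0]
    simp only [zpow_add₀ hq0, zpow_one, zpow_neg]
    have hX := zpow_ne_zero s hq0
    have hs : ((-1 : ℂ) ^ s)⁻¹ = (-1) ^ s := by rw [← inv_zpow, inv_neg_one]
    rw [div_eq_mul_inv _ ((-1 : ℂ) ^ s), hs]
    field_simp
    ring
  have hsum : ∑' s, f s + ∑' s, f s = 0 := by
    nth_rewrite 2 [← hrefl]
    have hfs' : Summable fun s => f ((Equiv.subLeft (-1)) s) := 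
      hfs.comp_injective (Equiv.subLeft (-1 : ℤ)).injective
    rw [← hfs.tsum_add hfs']
    simp only [hpair, tsum_zero]
  rw [← two_mul] at hsum
  have h0 : ∑' s, f s = 0 := by simpa using hsum
  rw [hf, h3.tsum_sub h2, tsum_mul_left, sub_eq_zero] at h0
  exact h0

theorem reflectionSum_bound_zero (q : ℂ) (e : ℤ) : reflectionSum q e 0 = 1 := by
  rw [reflectionSum, tsum_eq_single 0]
  · have h := qFactorialInv_natCast q 0
    simp only [qPochhammer, Finset.range_zero, Finset.prod_empty, inv_one, Nat.cast_zero] at h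
    simp [reflectionTerm, h]
  · intro s hs
    exact reflectionTerm_eq_zero q e fun h => hs (le_antisymm h.2 (by simpa using h.1))

/-- The profile $(l,m)$ corresponds to $e=(m-l)/2$. Both families satisfy the same recurrences and
equal 1 at $N=0$. -/
theorem pairGF_eq_reflectionSum {q : ℂ} (hq0 : q ≠ 0) (hq : ‖q‖ < 1) (N : ℕ) :
    pairGF q (linkedPairs 2 2 N) = reflectionSum q 0 N ∧
    pairGF q (linkedPairs 1 3 N) = reflectionSum q 1 N ∧
    pairGF q (linkedPairs 0 4 N) = reflectionSum q 2 N := by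
  induction N with
  | zero => simp only [pairGF_bound_zero, Nat.cast_zero, reflectionSum_bound_zero, and_self]
  | succ N ih =>
    obtain ⟨i0, i1, i2⟩ := ih
    have p0 := pairGF_recurrence hq 1 1 N
    have p1 := pairGF_recurrence hq 0 2 N
    have p2 := pairGF_recurrence_zero hq 3 N
    have r0 := reflectionSum_recurrence hq0 hq 0 N
    have r1 := reflectionSum_recurrence hq0 hq 1 N
    have r2 := reflectionSum_recurrence hq0 hq 2 N
    simp only [Nat.reduceAdd, zero_add] at p0 p1 p2
    norm_num only at r0 r1 r2
    rw [pairGF_swap q 3 1] at p0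
    rw [reflectionSum_neg] at r0
    rw [reflectionSum_three hq0 hq] at r2
    rw [i0] at p0
    rw [i1] at p1
    rw [i2] at p2
    push_cast
    have hx := one_sub_pow_ne_zero hq (n := N + 1 + (N + 1)) (by omega)
    have hz : q ^ ((N : ℤ) + 1) = q ^ (N + 1) := by exact_mod_cast zpow_natCast q (N + 1)
    have hz2 : q ^ (2 * ((N : ℤ) + 1)) = q ^ (N + 1) * q ^ (N + 1) := by
      rw [two_mul, zpow_add₀ hq0, hz]
    rw [hz, hz2] at r0 r1 r2
    rw [pow_add q (N + 1) (N + 1)] at hx p0 p1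
    generalize q ^ (N + 1) = x at *
    generalize pairGF q (linkedPairs 2 2 (N + 1)) = S0 at *
    generalize pairGF q (linkedPairs 1 3 (N + 1)) = S1 at *
    generalize pairGF q (linkedPairs 0 4 (N + 1)) = S2 at *
    generalize reflectionSum q 0 (N + 1) = T0 at *
    generalize reflectionSum q 1 (N + 1) = T1 at *
    generalize reflectionSum q 2 (N + 1) = T2 at *
    -- The differences solve the homogeneous system at level `N + 1`. Eliminating from the wall
    -- inwards leaves $(1-x^2)(S_0-T_0)=0$ with $x=q^{N+1}$, and $x^2\ne 1$.
    have h2 : S2 - T2 = x * (S1 - T1) := by linear_combination p2 - r2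
    have h1 : S1 - T1 = x * (S0 - T0) := by linear_combination p1 - r1 + x * h2
    have h0 : (1 - x * x) * (S0 - T0) = 0 := by
      linear_combination p0 - r0 + 2 * x * h1
    have h0' : S0 - T0 = 0 := (mul_eq_zero.1 h0).resolve_left hx
    have h1' : S1 - T1 = 0 := by rw [h1, h0', mul_zero]
    exact ⟨sub_eq_zero.1 h0', sub_eq_zero.1 h1', sub_eq_zero.1 (by rw [h2, h1', mul_zero])⟩

/-! ### Infinite products and Euler's identity -/

theorem summable_norm_neg_mul_pow (a : ℂ) {q : ℂ} (hq : ‖q‖ < 1) :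
    Summable fun k : ℕ => ‖-(a * q ^ k)‖ := by
  simp only [norm_neg, norm_mul, norm_pow]
  exact (summable_geometric_of_lt_one (norm_nonneg q) hq).mul_left _

theorem tendsto_qPochhammer_tprod (a : ℂ) {q : ℂ} (hq : ‖q‖ < 1) :
    Tendsto (qPochhammer a q) atTop (𝓝 (∏' k : ℕ, (1 - a * q ^ k))) := by
  have h := (multipliable_one_add_of_summable (summable_norm_neg_mul_pow a hq)).hasProd
  simp only [← sub_eq_add_neg] at h
  exact h.tendsto_prod_nat

theorem qPochhammerInf_eq_tprod (a : ℂ) {q : ℂ} (hq : ‖q‖ < 1) :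
    qPochhammerInf a q = ∏' k : ℕ, (1 - a * q ^ k) :=
  (tendsto_qPochhammer_tprod a hq).limUnder_eq

theorem tendsto_qPochhammer (a : ℂ) {q : ℂ} (hq : ‖q‖ < 1) :
    Tendsto (qPochhammer a q) atTop (𝓝 (qPochhammerInf a q)) := by
  rw [qPochhammerInf_eq_tprod a hq]
  exact tendsto_qPochhammer_tprod a hq

theorem qPochhammerInf_self_ne_zero {q : ℂ} (hq : ‖q‖ < 1) : qPochhammerInf q q ≠ 0 := by
  have h := tprod_one_add_ne_zero_of_summable (f := fun k : ℕ => -(q * q ^ k)) (fun k => by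
    rw [← sub_eq_add_neg, ← pow_succ']
    exact one_sub_pow_ne_zero hq k.succ_ne_zero) (summable_norm_neg_mul_pow q hq)
  simp only [← sub_eq_add_neg] at h
  rwa [qPochhammerInf_eq_tprod q hq]

theorem norm_sq_lt_one {q : ℂ} (hq : ‖q‖ < 1) : ‖q ^ 2‖ < 1 := by
  rw [norm_pow]; exact pow_lt_one₀ (norm_nonneg q) hq two_ne_zero

theorem qPochhammerInf_neg_mul_self {q : ℂ} (hq : ‖q‖ < 1) :
    qPochhammerInf (-q) q * qPochhammerInf q q = qPochhammerInf (q ^ 2) (q ^ 2) := by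
  have h1 := (tendsto_qPochhammer (-q) hq).mul (tendsto_qPochhammer q hq)
  have h2 := tendsto_qPochhammer (q ^ 2) (norm_sq_lt_one hq)
  refine tendsto_nhds_unique h1 (h2.congr fun n => ?_)
  rw [qPochhammer, qPochhammer, qPochhammer, ← Finset.prod_mul_distrib]
  refine Finset.prod_congr rfl fun k _ => ?_
  rw [← pow_mul]
  ring

theorem qPochhammerInf_even_mul_odd {q : ℂ} (hq : ‖q‖ < 1) :
    qPochhammerInf (-q) (q ^ 2) * qPochhammerInf (-q ^ 2) (q ^ 2) = qPochhammerInf (-q) q := by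
  have hq2 := norm_sq_lt_one hq
  have h1 := (tendsto_qPochhammer (-q) hq2).mul (tendsto_qPochhammer (-q ^ 2) hq2)
  have h2 := (tendsto_qPochhammer (-q) hq).comp (tendsto_id.const_mul_atTop' (two_pos (α := ℕ)))
  refine tendsto_nhds_unique h1 (h2.congr fun n => ?_)
  simp only [Function.comp_apply, id_eq]
  induction n with
  | zero => simp [qPochhammer]
  | succ n ih =>
    rw [show 2 * (n + 1) = 2 * n + 1 + 1 by ring, qPochhammer_succ, qPochhammer_succ, ih,
      qPochhammer_succ,
      qPochhammer_succ, ← pow_mul]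
    ring

/-- The reciprocals converge because the limit of the products is nonzero, and a convergent sequence
is bounded. -/
theorem exists_norm_inv_qPochhammer_le {q : ℂ} (hq : ‖q‖ < 1) :
    ∃ C : ℝ, ∀ n, ‖(qPochhammer q q n)⁻¹‖ ≤ C := by
  have h := ((tendsto_qPochhammer q hq).inv₀ (qPochhammerInf_self_ne_zero hq)).norm
  obtain ⟨C, hC⟩ := h.bddAbove_range
  exact ⟨C, fun n => hC ⟨n, rfl⟩⟩

theorem summable_sq_pow_div_qPochhammer {q : ℂ} (hq : ‖q‖ < 1) :
    Summable fun n : ℕ => q ^ (n ^ 2) / qPochhammer (q ^ 2) (q ^ 2) n := by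
  obtain ⟨C, hC⟩ := exists_norm_inv_qPochhammer_le (norm_sq_lt_one hq)
  refine Summable.of_norm_bounded
    ((summable_geometric_of_lt_one (norm_nonneg q) hq).mul_right C) fun n => ?_
  rw [div_eq_mul_inv, norm_mul, norm_pow]
  refine mul_le_mul ?_ (hC n) (norm_nonneg _) (pow_nonneg (norm_nonneg q) _)
  exact pow_le_pow_of_le_one (norm_nonneg q) hq.le (Nat.le_self_pow two_ne_zero n)

/-- Euler's identity `∑ q^(n²) / (q²; q²)_n = (-q; q²)_∞`. -/
theorem tsum_sq_pow_div_qPochhammer {q : ℂ} (hq : ‖q‖ < 1) :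
    ∑' n : ℕ, q ^ (n ^ 2) / qPochhammer (q ^ 2) (q ^ 2) n = qPochhammerInf (-q) (q ^ 2) := by
  have hq2 := norm_sq_lt_one hq
  set c : ℕ → ℂ := fun n => q ^ (n ^ 2) / qPochhammer (q ^ 2) (q ^ 2) n with hc
  have hcs : Summable c := summable_sq_pow_div_qPochhammer hq
  have hstep (n : ℕ) : (1 - (q ^ 2) ^ (n + 1)) * c (n + 1) = q * ((q ^ 2) ^ n * c n) := by
    have h1 := one_sub_pow_ne_zero hq2 n.succ_ne_zero
    have h2 := qPochhammer_self_ne_zero hq2 n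
    simp only [hc]
    rw [qPochhammer_succ, ← pow_succ']
    field_simp
    ring
  have hle (m k : ℕ) : ‖((q ^ 2) ^ m) ^ k * c k‖ ≤ ‖c k‖ := by
    rw [norm_mul, norm_pow, norm_pow]
    exact mul_le_of_le_one_left (norm_nonneg _)
      (pow_le_one₀ (by positivity) (pow_le_one₀ (norm_nonneg _) hq2.le))
  have hsum (m : ℕ) : Summable fun k => ((q ^ 2) ^ m) ^ k * c k :=
    Summable.of_norm_bounded hcs.norm (hle m)
  -- With $F(z)=\sum_k c_kz^k$, `hstep` amounts to $F(z)=(1+qz)F(q^2z)$. It is needed only at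
  -- $z=q^{2m}$; iterating from $z=1$ and letting $z\to 0$, where $F(0)=1$, gives the product.
  have hfun (m : ℕ) : ∑' k, ((q ^ 2) ^ m) ^ k * c k =
      (1 + q * (q ^ 2) ^ m) * ∑' k, ((q ^ 2) ^ (m + 1)) ^ k * c k := by
    have e1 := (hsum m).tsum_eq_zero_add
    have e2 := (hsum (m + 1)).tsum_eq_zero_add
    have s1 := (summable_nat_add_iff 1).2 (hsum m)
    have s2 := (summable_nat_add_iff 1).2 (hsum (m + 1))
    have e3 : ∑' k, ((q ^ 2) ^ m) ^ (k + 1) * c (k + 1) -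
        ∑' k, ((q ^ 2) ^ (m + 1)) ^ (k + 1) * c (k + 1) =
        q * (q ^ 2) ^ m * ∑' k, ((q ^ 2) ^ (m + 1)) ^ k * c k := by
      rw [← s1.tsum_sub s2, ← tsum_mul_left]
      refine tsum_congr fun k => ?_
      rw [show (q ^ 2) ^ (m + 1) = (q ^ 2) ^ m * q ^ 2 from pow_succ _ _, mul_pow, mul_pow]
      linear_combination ((q ^ 2) ^ m) ^ (k + 1) * hstep k
    rw [add_mul, one_mul, ← e3]
    rw [e1, e2]
    simp only [pow_zero]
    ring
  have hiter (m : ℕ) : ∑' k, c k = qPochhammer (-q) (q ^ 2) m * ∑' k, ((q ^ 2) ^ m) ^ k * c k := by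
    induction m with
    | zero => simp [qPochhammer]
    | succ m ih => rw [ih, hfun, qPochhammer_succ]; ring
  have hlim : Tendsto (fun m : ℕ => ∑' k, ((q ^ 2) ^ m) ^ k * c k) atTop
      (𝓝 (∑' k, (0 : ℂ) ^ k * c k)) := by
    refine tendsto_tsum_of_dominated_convergence hcs.norm (fun k => ?_)
      (Eventually.of_forall fun m k => hle m k)
    exact ((tendsto_pow_atTop_nhds_zero_of_norm_lt_one hq2).pow k).mul_const _
  have h0 : ∑' k, (0 : ℂ) ^ k * c k = 1 := by
    rw [tsum_eq_single 0 fun k hk => by rw [zero_pow hk, zero_mul]]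
    simp [hc, qPochhammer]
  rw [h0] at hlim
  have h := (tendsto_qPochhammer (-q) hq2).mul hlim
  rw [mul_one] at h
  exact tendsto_nhds_unique (tendsto_const_nhds.congr hiter) h

/-! ### Pentagonal numbers and the limit of the alternating sum -/

theorem summable_zpow_three_mul_sq_add {r : ℝ} (h0 : 0 ≤ r) (h1 : r < 1) :
    Summable fun s : ℤ => r ^ (3 * s ^ 2 + s).toNat := by
  have hg := summable_geometric_of_lt_one h0 h1
  refine Summable.of_nat_of_neg
    (hg.of_nonneg_of_le (fun n => pow_nonneg h0 _) fun n => pow_le_pow_of_le_one h0 h1.le ?_)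
    (hg.of_nonneg_of_le (fun n => pow_nonneg h0 _) fun n => pow_le_pow_of_le_one h0 h1.le ?_)
  · rw [Int.le_toNat (by positivity)]
    nlinarith
  · have : (n : ℤ) ≤ (n : ℤ) ^ 2 := by exact_mod_cast Nat.le_self_pow two_ne_zero n
    rw [Int.le_toNat (by nlinarith)]
    nlinarith

theorem three_mul_sq_add_nonneg (s : ℤ) : 0 ≤ 3 * s ^ 2 + s := by
  nlinarith [Int.le_self_sq (-s), sq_nonneg s]

/-- The pentagonal number theorem for complex numbers in the open unit disc. -/
theorem tprod_one_sub_pow_eq_pentagonal {x : ℂ} (hx : ‖x‖ < 1) :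
    ∏' n : ℕ, (1 - x ^ (n + 1)) =
      ∑' k : ℕ, (-1) ^ k * (x ^ pentagonal (-k) - x ^ pentagonal (k + 1)) := by
  have hg := summable_geometric_of_lt_one (norm_nonneg x) hx
  have hle (n m : ℕ) (h : n ≤ m) : ‖x‖ ^ m ≤ ‖x‖ ^ n :=
    pow_le_pow_of_le_one (norm_nonneg x) hx.le h
  -- a uniform bound for the finite products
  obtain ⟨C, hC⟩ : ∃ C : ℝ, ∀ k n : ℕ, ‖∏ i ∈ Finset.range n, (1 - x ^ (k + i + 1))‖ ≤ C := by
    refine ⟨Real.exp (∑' i : ℕ, ‖x‖ ^ i), fun k n => ?_⟩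
    rw [norm_prod]
    calc ∏ i ∈ Finset.range n, ‖1 - x ^ (k + i + 1)‖
        ≤ ∏ i ∈ Finset.range n, Real.exp (‖x‖ ^ i) := by
          refine Finset.prod_le_prod (fun _ _ => norm_nonneg _) fun i _ => ?_
          calc ‖1 - x ^ (k + i + 1)‖ ≤ ‖(1 : ℂ)‖ + ‖x ^ (k + i + 1)‖ := norm_sub_le _ _
            _ ≤ ‖x‖ ^ i + 1 := by
              rw [norm_one, norm_pow, add_comm]
              have := hle i (k + i + 1) (by omega)
              linarith
            _ ≤ _ := Real.add_one_le_exp _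
      _ = Real.exp (∑ i ∈ Finset.range n, ‖x‖ ^ i) := (Real.exp_sum _ _).symm
      _ ≤ _ := Real.exp_le_exp.2
          (hg.sum_le_tsum _ fun i _ => pow_nonneg (norm_nonneg x) i)
  have hC0 : 0 ≤ C := (norm_nonneg _).trans (hC 0 0)
  have hterm (k n : ℕ) : ‖x ^ ((k + 1) * n) * ∏ i ∈ Finset.range (n + 1), (1 - x ^ (k + i + 1))‖
      ≤ ‖x‖ ^ n * C := by
    rw [norm_mul, norm_pow]
    refine mul_le_mul (hle _ _ ?_) (hC k (n + 1)) (norm_nonneg _) (pow_nonneg (norm_nonneg x) n)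
    exact Nat.le_mul_of_pos_left n k.succ_pos
  have hpent1 (k : ℕ) : k ≤ pentagonal (-k) := by
    have := two_mul_natCast_pentagonal_neg k
    zify
    nlinarith
  have hpent2 (k : ℕ) : k ≤ pentagonal (k + 1) := by
    have := two_mul_natCast_pentagonal (k + 1)
    zify
    nlinarith
  -- The remaining goals are the convergence conditions of the formal identity, all met by geometric
  -- domination with the uniform bound `C`.
  refine Pentagonal.tprod_one_sub_pow ?_ (fun k => ?_) (fun k => ?_) ?_ ?_
  · exact tendsto_pow_atTop_nhds_zero_of_norm_lt_one hx
  · exact Summable.of_norm_bounded (hg.mul_right C) (hterm k)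
  · have h := multipliable_one_add_of_summable (summable_norm_neg_mul_pow (x ^ (k + 1)) hx)
    refine h.congr fun n => ?_
    rw [← sub_eq_add_neg, ← pow_add]
    ring_nf
  · refine Summable.of_norm_bounded (hg.mul_right 2) fun k => ?_
    rw [norm_mul, norm_pow, norm_neg, norm_one, one_pow, one_mul, mul_two]
    refine (norm_sub_le _ _).trans (add_le_add ?_ ?_) <;> rw [norm_pow]
    · exact hle _ _ (hpent1 k)
    · exact hle _ _ (hpent2 k)
  · refine squeeze_zero_norm (a := fun k => ‖x‖ ^ k * ∑' n : ℕ, ‖x‖ ^ n * C) (fun k => ?_) ?_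
    · rw [norm_mul, norm_mul, norm_pow, norm_neg, norm_one, one_pow, one_mul, norm_pow]
      refine mul_le_mul (hle _ _ ?_) ?_ (norm_nonneg _) (pow_nonneg (norm_nonneg x) k)
      · rw [Nat.le_div_iff_mul_le two_pos]
        nlinarith
      · exact tsum_of_norm_bounded (hg.mul_right C).hasSum (hterm k)
    · simpa using (tendsto_pow_atTop_nhds_zero_of_lt_one (norm_nonneg x) hx).mul_const _

theorem tsum_neg_one_zpow_mul_zpow {q : ℂ} (hq : ‖q‖ < 1) :
    ∑' s : ℤ, (-1) ^ s * q ^ (3 * s ^ 2 + s) = qPochhammerInf (q ^ 2) (q ^ 2) := by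
  have hq2 := norm_sq_lt_one hq
  have hcast (s : ℤ) : q ^ (3 * s ^ 2 + s) = q ^ (3 * s ^ 2 + s).toNat := by
    rw [← zpow_natCast, Int.toNat_of_nonneg (three_mul_sq_add_nonneg s)]
  have hs : Summable fun s : ℤ => (-1) ^ s * q ^ (3 * s ^ 2 + s) := by
    refine Summable.of_norm ((summable_zpow_three_mul_sq_add (norm_nonneg q) hq).congr fun s => ?_)
    rw [norm_mul, norm_zpow, norm_neg, norm_one, one_zpow, one_mul, hcast, norm_pow]
  obtain ⟨f, hf⟩ : ∃ f : ℤ → ℂ, f = fun s => (-1) ^ s * q ^ (3 * s ^ 2 + s) := ⟨_, rfl⟩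
  rw [← hf] at hs ⊢
  have hpos : Summable fun k : ℕ => f k := hs.comp_injective Nat.cast_injective
  have hneg : Summable fun k : ℕ => f (-((k : ℤ) + 1)) :=
    hs.comp_injective fun a b (h : -((a : ℤ) + 1) = -((b : ℤ) + 1)) => by omega
  rw [tsum_of_nat_of_neg_add_one hpos hneg, ← hpos.tsum_add hneg, qPochhammerInf_eq_tprod _ hq2]
  simp only [← pow_succ']
  rw [tprod_one_sub_pow_eq_pentagonal hq2]
  simp only [hf]
  refine tsum_congr fun k => ?_
  -- The exponent $3s^2+s$ is twice the pentagonal number of index $-s$, which is why the theorem is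
  -- applied at $q^2$.
  have e1 : 3 * (k : ℤ) ^ 2 + k = ((2 * pentagonal (-k) : ℕ) : ℤ) := by
    push_cast
    rw [two_mul_natCast_pentagonal_neg]
    ring
  have e2 : 3 * (-((k : ℤ) + 1)) ^ 2 + -((k : ℤ) + 1) = ((2 * pentagonal (k + 1) : ℕ) : ℤ) := by
    push_cast
    rw [two_mul_natCast_pentagonal]
    ring
  rw [e1, e2, zpow_natCast, zpow_natCast, zpow_natCast, pow_mul, pow_mul, zpow_neg, ← inv_zpow,
    inv_neg_one, zpow_add₀ (by norm_num), zpow_natCast]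
  ring

theorem tendsto_qFactorialInv {q : ℂ} (hq : ‖q‖ < 1) :
    Tendsto (qFactorialInv q) atTop (𝓝 (qPochhammerInf q q)⁻¹) := by
  have h := (tendsto_qPochhammer q hq).inv₀ (qPochhammerInf_self_ne_zero hq)
  have htn : Tendsto Int.toNat atTop atTop :=
    tendsto_atTop_atTop.2 fun b => ⟨b, fun a ha => by omega⟩
  refine (h.comp htn).congr' ?_
  filter_upwards [eventually_ge_atTop 0] with n hn
  rw [qFactorialInv, if_neg (not_lt.2 hn)]
  rfl

/-- Dominated convergence: each reciprocal factor tends to $1/(q;q)_\infty$, and the terms are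
bounded by $C^2|q|^{3s^2+s}$. -/
theorem tendsto_reflectionSum_one {q : ℂ} (hq : ‖q‖ < 1) :
    Tendsto (fun N : ℕ => reflectionSum q 1 N) atTop
      (𝓝 (qPochhammerInf (q ^ 2) (q ^ 2) / (qPochhammerInf q q * qPochhammerInf q q))) := by
  obtain ⟨C, hC⟩ := exists_norm_inv_qPochhammer_le hq
  have hC' (n : ℤ) : ‖qFactorialInv q n‖ ≤ C := by
    rw [qFactorialInv]
    split_ifs
    · rw [norm_zero]; exact (norm_nonneg _).trans (hC 0)
    · exact hC _
  have hC0 : 0 ≤ C := (norm_nonneg _).trans (hC 0)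
  rw [← tsum_neg_one_zpow_mul_zpow hq, div_eq_mul_inv, mul_inv, ← tsum_mul_right]
  refine tendsto_tsum_of_dominated_convergence
    ((summable_zpow_three_mul_sq_add (norm_nonneg q) hq).mul_right (C * C)) (fun s => ?_)
    (Eventually.of_forall fun N s => ?_)
  · simp only [reflectionTerm, one_mul]
    have h := tendsto_qFactorialInv hq
    have hN := tendsto_natCast_atTop_atTop (R := ℤ)
    refine Tendsto.const_mul _ ((h.comp ?_).mul (h.comp ?_))
    · exact tendsto_atTop_add_const_right _ (-s) hN
    · exact tendsto_atTop_add_const_right _ s hN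
  · rw [reflectionTerm, norm_mul, norm_mul, norm_mul, norm_zpow, norm_neg, norm_one, one_zpow,
      one_mul, one_mul, ← Int.toNat_of_nonneg (three_mul_sq_add_nonneg s), zpow_natCast, norm_pow]
    simp only [Int.toNat_natCast]
    exact mul_le_mul_of_nonneg_left (mul_le_mul (hC' _) (hC' _) (norm_nonneg _) hC0)
      (pow_nonneg (norm_nonneg q) _)

theorem qPochhammerInf_quotient {q : ℂ} (hq : ‖q‖ < 1) :
    qPochhammerInf (q ^ 2) (q ^ 2) / (qPochhammerInf q q * qPochhammerInf q q) =
      (∑' n : ℕ, q ^ (n ^ 2) / qPochhammer (q ^ 2) (q ^ 2) n) *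
        (qPochhammerInf (-q ^ 2) (q ^ 2) / qPochhammerInf q q) := by
  have h := qPochhammerInf_self_ne_zero hq
  rw [tsum_sq_pow_div_qPochhammer hq, ← mul_div_assoc, qPochhammerInf_even_mul_odd hq,
    ← qPochhammerInf_neg_mul_self hq, mul_div_mul_right _ _ h]

/-! ### Removing the bound on the parts -/

namespace CylindricPartition

/-- The cylindric partitions of profile `(1, 1, 0, 0)` with all parts at most `N`. -/
def bounded (N : ℕ) : Set (CylindricPartition (![1, 1, 0, 0] : Fin 4 → ℕ)) :=
  {Λ | (Λ.chainFst, Λ.chainSnd) ∈ linkedPairs 1 3 N}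

theorem exists_forall_ge_mem_bounded (Λ : CylindricPartition (![1, 1, 0, 0] : Fin 4 → ℕ)) :
    ∃ N, ∀ M, N ≤ M → Λ ∈ bounded M :=
  ⟨max (Λ.part 0 0) (Λ.part 1 0), fun _ hM => Λ.chains_mem_linkedPairs
    ((le_max_left _ _).trans hM) ((le_max_right _ _).trans hM)⟩

theorem indicator_bounded (q : ℂ) (N : ℕ) (Λ : CylindricPartition (![1, 1, 0, 0] : Fin 4 → ℕ)) :
    (bounded N).indicator (fun Λ => q ^ Λ.size) Λ =
      (linkedPairs 1 3 N).indicator (fun p => q ^ pairSize p) (Λ.chainFst, Λ.chainSnd) := by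
  classical
  simp only [Set.indicator_apply, size_eq_pairSize]
  rfl

theorem summable_indicator_bounded {q : ℂ} (hq : ‖q‖ < 1) (N : ℕ) :
    Summable ((bounded N).indicator fun Λ => q ^ Λ.size) :=
  ((summable_indicator_of_subset_linkedPairs hq subset_rfl).comp_injective
    chains_injective).congr fun Λ => (indicator_bounded q N Λ).symm

theorem tsum_indicator_bounded (q : ℂ) (N : ℕ) :
    ∑' Λ, (bounded N).indicator (fun Λ => q ^ Λ.size) Λ = pairGF q (linkedPairs 1 3 N) := by
  rw [pairGF, tsum_subtype _ (fun p => q ^ pairSize p), tsum_congr (indicator_bounded q N)]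
  refine chains_injective.tsum_eq
    (f := (linkedPairs 1 3 N).indicator fun p => q ^ pairSize p) fun p hp => ?_
  exact exists_chains_eq (Set.mem_of_indicator_ne_zero hp)

theorem tendsto_tsum_indicator_bounded {q : ℂ} (hq0 : q ≠ 0) (hq : ‖q‖ < 1) :
    Tendsto (fun N => ∑' Λ, (bounded N).indicator (fun Λ => q ^ Λ.size) Λ) atTop
      (𝓝 (qPochhammerInf (q ^ 2) (q ^ 2) / (qPochhammerInf q q * qPochhammerInf q q))) :=
  (tendsto_reflectionSum_one hq).congr fun N => by
    rw [tsum_indicator_bounded, (pairGF_eq_reflectionSum hq0 hq N).2.1]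

/-- The bounded formula at the real point $|q|$ gives a convergent, hence bounded, sequence of sums.
Every finite set of cylindric partitions lies in some `bounded M`, so all finite partial sums share
that bound. -/
theorem summable_norm_pow_size {q : ℂ} (hq0 : q ≠ 0) (hq : ‖q‖ < 1) :
    Summable fun Λ : CylindricPartition (![1, 1, 0, 0] : Fin 4 → ℕ) => ‖q‖ ^ Λ.size := by
  have hr0 : (‖q‖ : ℂ) ≠ 0 := by simpa using hq0
  have hr : ‖(‖q‖ : ℂ)‖ < 1 := by simpa using hq
  have h0 (Λ : CylindricPartition (![1, 1, 0, 0] : Fin 4 → ℕ)) : 0 ≤ ‖q‖ ^ Λ.size :=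
    pow_nonneg (norm_nonneg q) _
  obtain ⟨C, hC⟩ := (tendsto_tsum_indicator_bounded hr0 hr).norm.bddAbove_range
  refine summable_of_sum_le (c := C) h0 fun F => ?_
  choose N hN using exists_forall_ge_mem_bounded
  set M := F.sup N
  have hmem : ∀ Λ ∈ F, Λ ∈ bounded M := fun Λ hΛ => hN Λ M (Finset.le_sup hΛ)
  have hcast (Λ : CylindricPartition (![1, 1, 0, 0] : Fin 4 → ℕ)) :
      (bounded M).indicator (fun Λ => (‖q‖ : ℂ) ^ Λ.size) Λ =
        ((bounded M).indicator (fun Λ => ‖q‖ ^ Λ.size) Λ : ℝ) := by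
    classical
    simp only [Set.indicator_apply]
    split_ifs <;> simp
  have hs := summable_indicator_bounded hr M
  have hs' : Summable ((bounded M).indicator fun Λ => ‖q‖ ^ Λ.size) :=
    Complex.summable_ofReal.1 (hs.congr hcast)
  calc ∑ Λ ∈ F, ‖q‖ ^ Λ.size
      = ∑ Λ ∈ F, (bounded M).indicator (fun Λ => ‖q‖ ^ Λ.size) Λ :=
        Finset.sum_congr rfl fun Λ hΛ => (Set.indicator_of_mem (hmem Λ hΛ) fun Λ => ‖q‖ ^ Λ.size).symm
    _ ≤ ∑' Λ, (bounded M).indicator (fun Λ => ‖q‖ ^ Λ.size) Λ :=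
        hs'.sum_le_tsum F fun Λ _ => Set.indicator_nonneg (fun Λ _ => h0 Λ) Λ
    _ ≤ ‖((∑' Λ, (bounded M).indicator (fun Λ => ‖q‖ ^ Λ.size) Λ : ℝ) : ℂ)‖ := by
        rw [Complex.norm_real]; exact le_abs_self _
    _ = ‖∑' Λ, (bounded M).indicator (fun Λ => (‖q‖ : ℂ) ^ Λ.size) Λ‖ := by
        rw [Complex.ofReal_tsum, tsum_congr hcast]
    _ ≤ C := hC ⟨M, rfl⟩

theorem hasSum_pow_size {q : ℂ} (hq0 : q ≠ 0) (hq : ‖q‖ < 1) :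
    HasSum (fun Λ : CylindricPartition (![1, 1, 0, 0] : Fin 4 → ℕ) => q ^ Λ.size)
      (qPochhammerInf (q ^ 2) (q ^ 2) / (qPochhammerInf q q * qPochhammerInf q q)) := by
  have hs := summable_norm_pow_size hq0 hq
  have hlim : Tendsto (fun N => ∑' Λ, (bounded N).indicator (fun Λ => q ^ Λ.size) Λ) atTop
      (𝓝 (∑' Λ : CylindricPartition (![1, 1, 0, 0] : Fin 4 → ℕ), q ^ Λ.size)) := by
    refine tendsto_tsum_of_dominated_convergence hs (fun Λ => ?_)
      (Eventually.of_forall fun N Λ => ?_)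
    · obtain ⟨N, hN⟩ := exists_forall_ge_mem_bounded Λ
      refine tendsto_const_nhds.congr' ?_
      filter_upwards [eventually_ge_atTop N] with M hM
      exact (Set.indicator_of_mem (hN M hM) fun Λ => q ^ Λ.size).symm
    · rw [← norm_pow]
      exact norm_indicator_le_norm_self _ _
  rw [tendsto_nhds_unique (tendsto_tsum_indicator_bounded hq0 hq) hlim]
  exact (Summable.of_norm (hs.congr fun Λ => (norm_pow _ _).symm)).hasSum

/-! ### The case q = 0 and the theorem -/

theorem eq_zero_of_size_eq_zero {r : ℕ} [NeZero r] {c : Fin r → ℕ} {Λ : CylindricPartition c}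
    (h : Λ.size = 0) (i : Fin r) (j : ℕ) : Λ.part i j = 0 := by
  have hi := Finset.sum_eq_zero_iff.1 h i (Finset.mem_univ i)
  have := single_le_finsum j (Λ.finite_support i) (fun _ => Nat.zero_le _)
  exact Nat.le_zero.1 (this.trans_eq hi)

theorem hasSum_zero_pow_size {r : ℕ} [NeZero r] (c : Fin r → ℕ) :
    HasSum (fun Λ : CylindricPartition c => (0 : ℂ) ^ Λ.size) 1 := by
  let Z : CylindricPartition c :=
    { part := fun _ _ => 0
      antitone_part := fun _ _ _ _ => le_rfl
      finite_support := fun _ => by simp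
      cylindric := fun _ _ => le_rfl }
  have hZ : Z.size = 0 := by simp [size, Z]
  have h := hasSum_single (f := fun Λ : CylindricPartition c => (0 : ℂ) ^ Λ.size) Z fun Λ hΛ =>
    zero_pow fun h0 => hΛ (CylindricPartition.ext (funext fun i => funext fun j =>
      eq_zero_of_size_eq_zero h0 i j))
  rwa [hZ, pow_zero] at h

end CylindricPartition

theorem qPochhammerInf_zero (q : ℂ) : qPochhammerInf 0 q = 1 := by
  have h : qPochhammer 0 q = fun _ => 1 := by
    funext n
    simp [qPochhammer]
  rw [qPochhammerInf, h]
  exact tendsto_const_nhds.limUnder_eq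

/-- The generating function `∑ q^|Λ|` of the cylindric partitions `Λ` with profile `(1, 1, 0, 0)`,
for complex `q` in the open unit disc. The first five conjuncts say that the expression on the
right-hand side is well defined; the last one is the formula, with (absolute) convergence of the
generating function. -/
theorem mainTheorem12 (q : ℂ) (hq : ‖q‖ < 1) :
    Tendsto (qPochhammer (-q ^ 2) (q ^ 2)) atTop (𝓝 (qPochhammerInf (-q ^ 2) (q ^ 2))) ∧
    Tendsto (qPochhammer q q) atTop (𝓝 (qPochhammerInf q q)) ∧
    qPochhammerInf q q ≠ 0 ∧
    (∀ n : ℕ, qPochhammer (q ^ 2) (q ^ 2) n ≠ 0) ∧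
    Summable (fun n : ℕ => q ^ (n ^ 2) / qPochhammer (q ^ 2) (q ^ 2) n) ∧
    HasSum
      (fun Λ : CylindricPartition (![1, 1, 0, 0] : Fin 4 → ℕ) => q ^ Λ.size)
      ((∑' n : ℕ, q ^ (n ^ 2) / qPochhammer (q ^ 2) (q ^ 2) n) *
        (qPochhammerInf (-q ^ 2) (q ^ 2) / qPochhammerInf q q)) := by
  refine ⟨tendsto_qPochhammer _ (norm_sq_lt_one hq), tendsto_qPochhammer q hq,
    qPochhammerInf_self_ne_zero hq, qPochhammer_self_ne_zero (norm_sq_lt_one hq),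
    summable_sq_pow_div_qPochhammer hq, ?_⟩
  rw [← qPochhammerInf_quotient hq]
  -- The recurrences for the alternating sums use negative powers of `q`, so `q = 0` is separate:
  -- only the empty cylindric partition contributes.
  rcases eq_or_ne q 0 with rfl | hq0
  · rw [zero_pow two_ne_zero, qPochhammerInf_zero, mul_one, div_one]
    exact CylindricPartition.hasSum_zero_pow_size _
  · exact CylindricPartition.hasSum_pow_size hq0 hq
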